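/- For integers $m\ge 0$, $n\ge 0$ let $\mathrm{Gr}_{m,n}=\{P\in\mathbb{C}^{n\times n} : P^{H}=P,\ P^2=P,\ \operatorname{tr}P=m\}$ be the complex Grassmannian of Hermitian projectors, with the Riemannian metric $g_P(H_1,H_2)=\operatorname{tr}(H_1H_2)$ on its tangent spaces, and let $\operatorname{dist}$ be the Riemannian distance. Write $[X,Y]=XY-YX$, $\operatorname{ad}_XY=[X,Y]$, and for $Q\in\mathrm{Gr}_{m,n}$ and a tangent vector $\xi\in T_Q\mathrm{Gr}_{m,n}$ let $$\exp_Q(\xi)=e^{[\xi,Q]}\,Q\,e^{-[\xi,Q]}.$$ Let $\mathcal{B}=\{P\in\mathrm{Gr}_{m,n}:\operatorname{dist}(C,P)<r\}$, with $C\in\mathrm{Gr}_{m,n}$, be a geodesically convex open ball: any two points of $\mathcal{B}$ are joined by a unique shortest geodesic (parametrized over $[0,1]$) of $\mathrm{Gr}_{m,n}$, and this geodesic is contained in $\mathcal{B}$. Let $N\ge 1$, let $Q_1,\dots,Q_N\in\mathcal{B}$, and let $$F\colon\mathcal{B}\to\mathbb{R},\qquad F(P)=\frac1N\sum_{i=1}^N\operatorname{dist}^2(P,Q_i).$$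 Then for every $P\in\mathcal{B}$ and every $i$ there is a unique $\xi_i\in T_{Q_i}\mathrm{Gr}_{m,n}$ such that $P=\exp_{Q_i}(\xi_i)$ and $t\mapsto\exp_{Q_i}(t\xi_i)$, $0\le t\le 1$, is a shortest geodesic from $Q_i$ to $P$. Moreover $F$ is differentiable at $P$ (as a function on the manifold $\mathrm{Gr}_{m,n}$), and its Riemannian gradient there is $$\operatorname{grad}F(P)=\frac2N\sum_{i=1}^N\operatorname{ad}_{[\xi_i,Q_i]}P .$$ -/

import Mathlib

open scoped Matrix ContDiff Matrix.Norms.Frobenius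

noncomputable section

namespace KarcherGrassmann

/-- The space `ℂ^{n × n}`, with the Frobenius norm. -/
abbrev Mat (n : ℕ) : Type := Matrix (Fin n) (Fin n) ℂ

/-- The complex Grassmannian: Hermitian projectors of trace (that is, rank) `m`. -/
def Gr (m n : ℕ) : Set (Mat n) :=
  {P | Pᴴ = P ∧ P * P = P ∧ P.trace = (m : ℂ)}

/-- The trace form `⟨X, Y⟩ = tr (X Y)`; on Hermitian matrices the trace is real. Restricted to
the tangent spaces it is the Riemannian metric of the Grassmannian. -/
def metric {n : ℕ} (X Y : Mat n) : ℝ := (X * Y).trace.re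

/-- A smooth curve in the Grassmannian. -/
def IsSmoothCurve (m : ℕ) {n : ℕ} (γ : ℝ → Mat n) : Prop :=
  ContDiff ℝ ∞ γ ∧ ∀ t, γ t ∈ Gr m n

/-- The tangent space at `P`: all velocities at `P` of smooth curves in the Grassmannian. -/
def tangentSpace (m : ℕ) {n : ℕ} (P : Mat n) : Set (Mat n) :=
  {H | ∃ γ : ℝ → Mat n, IsSmoothCurve m γ ∧ γ 0 = P ∧ deriv γ 0 = H}

/-- The length of a curve parametrized by `[0, 1]`. -/
def curveLength {n : ℕ} (γ : ℝ → Mat n) : ℝ :=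
  ∫ t in (0 : ℝ)..1, √(metric (derivWithin γ (Set.Icc 0 1) t) (derivWithin γ (Set.Icc 0 1) t))

/-- The Riemannian distance: the infimum of the lengths of the `C¹` curves in the Grassmannian
from `P` to `Q`. (The Grassmannian is connected, so for two of its points such curves exist.) -/
def grDist (m : ℕ) {n : ℕ} (P Q : Mat n) : ℝ :=
  sInf {l : ℝ | ∃ γ : ℝ → Mat n, ContDiffOn ℝ 1 γ (Set.Icc 0 1) ∧
    (∀ t ∈ Set.Icc (0 : ℝ) 1, γ t ∈ Gr m n) ∧ γ 0 = P ∧ γ 1 = Q ∧ l = curveLength γ}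

/-- A geodesic of the Grassmannian, as a submanifold of the Euclidean space of Hermitian matrices:
a smooth curve whose acceleration is everywhere orthogonal to the tangent space, i.e. whose
covariant acceleration vanishes. Since the Grassmannian is compact, every geodesic segment is
the restriction of exactly one geodesic defined on all of `ℝ`. -/
def IsGeodesic (m : ℕ) {n : ℕ} (γ : ℝ → Mat n) : Prop :=
  IsSmoothCurve m γ ∧ ∀ t, ∀ H ∈ tangentSpace m (γ t), metric (deriv (deriv γ) t) H = 0

/-- `γ`, restricted to `[0, 1]`, is a shortest geodesic from `P` to `Q`. -/
def IsShortestGeodesic (m : ℕ) {n : ℕ} (P Q : Mat n) (γ : ℝ → Mat n) : Prop :=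
  IsGeodesic m γ ∧ γ 0 = P ∧ γ 1 = Q ∧ curveLength γ = grDist m P Q

/-- The open ball of the Riemannian distance. -/
def geodesicBall (m : ℕ) {n : ℕ} (C : Mat n) (r : ℝ) : Set (Mat n) :=
  {P | P ∈ Gr m n ∧ grDist m C P < r}

/-- Any two points of `B` are joined by a unique shortest geodesic, and it is contained in `B`. -/
def IsGeodesicallyConvex (m : ℕ) {n : ℕ} (B : Set (Mat n)) : Prop :=
  ∀ P ∈ B, ∀ Q ∈ B, ∃ γ : ℝ → Mat n, IsShortestGeodesic m P Q γ ∧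
    (∀ t ∈ Set.Icc (0 : ℝ) 1, γ t ∈ B) ∧ ∀ γ', IsShortestGeodesic m P Q γ' → γ' = γ

/-- The Riemannian exponential map, `exp_Q(H) = e^{[H, Q]} Q e^{-[H, Q]}`. -/
def grExp {n : ℕ} (Q H : Mat n) : Mat n :=
  NormedSpace.exp ⁅H, Q⁆ * Q * NormedSpace.exp (-⁅H, Q⁆)

/-- `ξ` is the tangent vector at `Q` with `P = exp_Q(ξ)` that belongs to a shortest geodesic
`t ↦ exp_Q(t ξ)`, `0 ≤ t ≤ 1`, from `Q` to `P`. -/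
def IsLogarithm (m : ℕ) {n : ℕ} (Q P ξ : Mat n) : Prop :=
  ξ ∈ tangentSpace m Q ∧ P = grExp Q ξ ∧ IsShortestGeodesic m Q P (fun t => grExp Q (t • ξ))

/-- `f` (of which only the values on the Grassmannian near `P` matter) is differentiable at `P` as
a function on the Grassmannian, and its Riemannian gradient at `P` is `G`: the tangent vector
with `(f ∘ γ)'(0) = ⟨G, γ'(0)⟩` for the smooth curves `γ`, in particular the geodesics, that
start in `P`. -/
def HasRiemannianGradientAt (m : ℕ) {n : ℕ} (f : Mat n → ℝ) (P G : Mat n) : Prop :=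
  G ∈ tangentSpace m P ∧ DifferentiableWithinAt ℝ f (Gr m n) P ∧
    ∀ γ : ℝ → Mat n, IsSmoothCurve m γ → γ 0 = P →
      HasDerivAt (fun t => f (γ t)) (metric G (deriv γ 0)) 0

/-- The Karcher mean function `F(P) = (1/N) ∑ dist²(P, Q_i)`. -/
def karcherMeanFunction (m : ℕ) {n N : ℕ} (Q : Fin N → Mat n) (P : Mat n) : ℝ :=
  (1 / (N : ℝ)) * ∑ i, grDist m P (Q i) ^ 2

end KarcherGrassmann

end

noncomputable section

namespace KarcherGrassmann

open scoped Topology Pointwise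
open Set Filter Asymptotics

/-! The core is that `dist²(Q, ·)` has gradient `2 ⁅⁅ξ, Q⁆, P⁆` at `P`, which is twice the final
velocity of the shortest geodesic from `Q` to `P`; averaging over the `Q i` gives the theorem.
Differentiability is obtained by squeezing, without smoothness of the distance or an injectivity
radius.

The upper bound (`grDist_conjExp_sq_le`) deforms the geodesic `γ` into `t ↦ e^{tA} γ(t) e^{-tA}`,
which ends at the conjugate of `P` by `e^A`. The momentum of `γ` is conserved, so the squared speed
is at most the first variation plus an error `4m‖A‖²`. Points `P'` of the Grassmannian near `P` are
such conjugates with `A = O(P' - P)` (`exists_conjExp_eq`).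

The lower bound is the same estimate with `P` and `P'` exchanged. It involves the logarithm of `P'`,
which must therefore converge to that of `P`; this follows from compactness and uniqueness
(`tendsto_logarithm`). Uniqueness comes from convexity, because geodesics are exactly the curves `t
↦ grExp Q (t • ξ)` (`isGeodesic_grExp`, `eq_grExp_of_isGeodesic`). -/

/-- Conjugation of `X` by `e^A`. -/
def conjExp {n : ℕ} (A X : Mat n) : Mat n :=
  NormedSpace.exp A * X * NormedSpace.exp (-A)

/-! ### Algebra and calculus of conjugation by exponentials. -/

lemma grExp_eq_conjExp {n : ℕ} (Q H : Mat n) : grExp Q H = conjExp ⁅H, Q⁆ Q := rfl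

lemma exp_mul_exp_neg {n : ℕ} (A : Mat n) :
    NormedSpace.exp A * NormedSpace.exp (-A) = 1 := by
  rw [← Matrix.exp_add_of_commute A (-A) ((Commute.refl A).neg_right), add_neg_cancel,
    NormedSpace.exp_zero]

lemma exp_neg_mul_exp {n : ℕ} (A : Mat n) :
    NormedSpace.exp (-A) * NormedSpace.exp A = 1 := by
  simpa using exp_mul_exp_neg (-A)

lemma conjExp_mul {n : ℕ} (A X Y : Mat n) :
    conjExp A (X * Y) = conjExp A X * conjExp A Y := by
  have h := exp_neg_mul_exp A
  simp only [conjExp]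
  calc _ = NormedSpace.exp A * X * 1 * Y * NormedSpace.exp (-A) := by noncomm_ring
    _ = _ := by rw [← h]; noncomm_ring

lemma conjExp_neg_conjExp {n : ℕ} (A X : Mat n) : conjExp (-A) (conjExp A X) = X := by
  have h := exp_neg_mul_exp A
  simp only [conjExp, neg_neg]
  calc _ = (NormedSpace.exp (-A) * NormedSpace.exp A) * X *
        (NormedSpace.exp (-A) * NormedSpace.exp A) := by noncomm_ring
    _ = X := by rw [h, one_mul, mul_one]

lemma conjExp_zero_left {n : ℕ} (X : Mat n) : conjExp 0 X = X := by
  simp [conjExp, NormedSpace.exp_zero]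

lemma conjExp_sub {n : ℕ} (A X Y : Mat n) :
    conjExp A (X - Y) = conjExp A X - conjExp A Y := by
  simp only [conjExp]; noncomm_ring

lemma conjExp_lie {n : ℕ} (A X Y : Mat n) :
    conjExp A ⁅X, Y⁆ = ⁅conjExp A X, conjExp A Y⁆ := by
  simp only [Ring.lie_def, conjExp_sub, conjExp_mul]

lemma conjExp_smul_self {n : ℕ} (A : Mat n) (t : ℝ) : conjExp (t • A) A = A := by
  have h : Commute (NormedSpace.exp (t • A)) A :=
    ((Commute.refl A).smul_left t).exp_left
  rw [conjExp, h.eq, mul_assoc, exp_mul_exp_neg, mul_one]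

lemma trace_conjExp {n : ℕ} (A X : Mat n) : (conjExp A X).trace = X.trace := by
  rw [conjExp, Matrix.trace_mul_comm, ← mul_assoc, exp_neg_mul_exp, one_mul]

lemma metric_conjExp {n : ℕ} (A X Y : Mat n) :
    metric (conjExp A X) (conjExp A Y) = metric X Y := by
  rw [metric, ← conjExp_mul, trace_conjExp, metric]

lemma conjTranspose_conjExp {n : ℕ} {A : Mat n} (hA : Aᴴ = -A) (X : Mat n) :
    (conjExp A X)ᴴ = conjExp A Xᴴ := by
  simp only [conjExp, Matrix.conjTranspose_mul, ← Matrix.exp_conjTranspose,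
    Matrix.conjTranspose_neg, hA, neg_neg, mul_assoc]

lemma conjExp_mem_Gr {m n : ℕ} {A P : Mat n} (hA : Aᴴ = -A) (hP : P ∈ Gr m n) :
    conjExp A P ∈ Gr m n := by
  obtain ⟨h1, h2, h3⟩ := hP
  refine ⟨?_, ?_, ?_⟩
  · rw [conjTranspose_conjExp hA, h1]
  · rw [← conjExp_mul, h2]
  · rw [trace_conjExp, h3]

lemma conjTranspose_real_smul {n : ℕ} (t : ℝ) (A : Mat n) : (t • A)ᴴ = t • Aᴴ := by
  rw [Matrix.conjTranspose_smul, star_trivial]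

lemma conjTranspose_smul_of_skew {n : ℕ} {A : Mat n} (hA : Aᴴ = -A) (t : ℝ) :
    (t • A)ᴴ = -(t • A) := by
  rw [conjTranspose_real_smul, hA, smul_neg]

lemma hasDerivAt_conjExp {n : ℕ} (A : Mat n) {γ : ℝ → Mat n} {γ' : Mat n} {t : ℝ}
    (h : HasDerivAt γ γ' t) :
    HasDerivAt (fun s => conjExp (s • A) (γ s)) (conjExp (t • A) (⁅A, γ t⁆ + γ')) t := by
  have h1 := hasDerivAt_exp_smul_const (𝕂 := ℝ) A t
  have h2 : HasDerivAt (fun u : ℝ => NormedSpace.exp (-(u • A)))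
      (-A * NormedSpace.exp (-(t • A))) t := by
    simp only [← smul_neg]
    exact hasDerivAt_exp_smul_const' (𝕂 := ℝ) (-A) t
  have key : ∀ E E' : Mat n, (E * A * γ t + E * γ') * E' + (E * γ t) * (-A * E') =
      E * (⁅A, γ t⁆ + γ') * E' := by
    intro E E'
    simp only [Ring.lie_def]
    noncomm_ring
  exact HasDerivAt.congr_deriv ((h1.mul h).mul h2) (key _ _)

lemma continuous_conjExp {n : ℕ} {ι : Type*} [TopologicalSpace ι] {f g : ι → Mat n}
    (hf : Continuous f) (hg : Continuous g) : Continuous fun x => conjExp (f x) (g x) := by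
  let : NormedAlgebra ℚ (Mat n) := .restrictScalars ℚ ℝ (Mat n)
  have h := NormedSpace.exp_continuous (𝔸 := Mat n)
  exact ((h.comp hf).mul hg).mul (h.comp hf.neg)

lemma contDiff_conjExp {n : ℕ} (A : Mat n) {γ : ℝ → Mat n} (hγ : ContDiff ℝ ∞ γ) :
    ContDiff ℝ ∞ fun t => conjExp (t • A) (γ t) := by
  have h : ContDiff ℝ ∞ (NormedSpace.exp : Mat n → Mat n) :=
    contDiff_iff_contDiffAt.2 fun x => (NormedSpace.exp_analytic (𝕂 := ℝ) x).contDiffAt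
  have h1 : ContDiff ℝ ∞ fun t : ℝ => t • A := by fun_prop
  unfold conjExp
  exact ((h.comp h1).mul hγ).mul (h.comp h1.neg)

lemma isSmoothCurve_conjExp {m n : ℕ} {A Q : Mat n} (hA : Aᴴ = -A) (hQ : Q ∈ Gr m n) :
    IsSmoothCurve m fun t : ℝ => conjExp (t • A) Q :=
  ⟨contDiff_conjExp A contDiff_const,
    fun t => conjExp_mem_Gr (conjTranspose_smul_of_skew hA t) hQ⟩

lemma hasDerivAt_conjExp_const {n : ℕ} (A Q : Mat n) (t : ℝ) :
    HasDerivAt (fun s : ℝ => conjExp (s • A) Q) (conjExp (t • A) ⁅A, Q⁆) t := by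
  simpa using hasDerivAt_conjExp A (hasDerivAt_const t Q)

/-! ### Tangent spaces -/

lemma lie_mem_tangentSpace {m n : ℕ} {A P : Mat n} (hA : Aᴴ = -A) (hP : P ∈ Gr m n) :
    ⁅A, P⁆ ∈ tangentSpace m P := by
  refine ⟨_, isSmoothCurve_conjExp hA hP, ?_, ?_⟩
  · simp [conjExp_zero_left]
  · exact (hasDerivAt_conjExp_const A P 0).deriv.trans (by rw [zero_smul, conjExp_zero_left])

lemma conjTranspose_deriv {n : ℕ} {γ : ℝ → Mat n} (h : ∀ t, (γ t)ᴴ = γ t) {t : ℝ}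
    (hd : DifferentiableAt ℝ γ t) : (deriv γ t)ᴴ = deriv γ t := by
  have h1 := hd.hasDerivAt.star
  have h2 : (fun x => star (γ x)) = γ := funext h
  rw [h2] at h1
  exact h1.unique hd.hasDerivAt

lemma deriv_mul_add_mul_deriv {n : ℕ} {γ : ℝ → Mat n} (h : ∀ t, γ t * γ t = γ t) {t : ℝ}
    (hd : DifferentiableAt ℝ γ t) : deriv γ t * γ t + γ t * deriv γ t = deriv γ t := by
  have h1 := hd.hasDerivAt.mul hd.hasDerivAt
  have h2 : γ * γ = γ := funext h
  rw [h2] at h1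
  exact h1.unique hd.hasDerivAt

lemma mul_mul_eq_zero_of_tangent {n : ℕ} {P H : Mat n} (hP : P * P = P)
    (hH : H * P + P * H = H) : P * H * P = 0 := by
  have := congrArg (fun X => X * P) hH
  simp only [add_mul, mul_assoc, hP] at this
  rw [mul_assoc]
  simpa using this

lemma lie_lie_eq_self {n : ℕ} {P H : Mat n} (hP : P * P = P) (hH : H * P + P * H = H) :
    ⁅⁅H, P⁆, P⁆ = H := by
  have h0 := mul_mul_eq_zero_of_tangent hP hH
  calc ⁅⁅H, P⁆, P⁆ = H * (P * P) + (P * P) * H - 2 • (P * H * P) := by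
        simp only [Ring.lie_def]; noncomm_ring
    _ = H := by rw [hP, h0, hH, smul_zero, sub_zero]

lemma conjTranspose_lie_skew {n : ℕ} {P H : Mat n} (hP : Pᴴ = P) (hH : Hᴴ = H) :
    ⁅H, P⁆ᴴ = -⁅H, P⁆ := by
  simp [Ring.lie_def, Matrix.conjTranspose_sub, hP, hH]

/-- Differentiating `γ² = γ` gives necessity. Conversely `H = ⁅⁅H, P⁆, P⁆` with `⁅H, P⁆`
skew-Hermitian, so `H` is the velocity of a unitary orbit. -/
lemma mem_tangentSpace_iff {m n : ℕ} {P H : Mat n} (hP : P ∈ Gr m n) :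
    H ∈ tangentSpace m P ↔ Hᴴ = H ∧ H * P + P * H = H := by
  constructor
  · rintro ⟨γ, ⟨hs, hg⟩, rfl, rfl⟩
    have hd : DifferentiableAt ℝ γ 0 := (hs.differentiable (by simp)) 0
    exact ⟨conjTranspose_deriv (fun t => (hg t).1) hd,
      deriv_mul_add_mul_deriv (fun t => (hg t).2.1) hd⟩
  · rintro ⟨h1, h2⟩
    have := lie_mem_tangentSpace (conjTranspose_lie_skew hP.1 h1) hP
    rwa [lie_lie_eq_self hP.2.1 h2] at this

lemma skew_of_mem_tangentSpace {m n : ℕ} {P H : Mat n} (hP : P ∈ Gr m n)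
    (hH : H ∈ tangentSpace m P) : ⁅H, P⁆ᴴ = -⁅H, P⁆ :=
  conjTranspose_lie_skew hP.1 ((mem_tangentSpace_iff hP).1 hH).1

lemma lie_lie_of_mem_tangentSpace {m n : ℕ} {P H : Mat n} (hP : P ∈ Gr m n)
    (hH : H ∈ tangentSpace m P) : ⁅⁅H, P⁆, P⁆ = H :=
  lie_lie_eq_self hP.2.1 ((mem_tangentSpace_iff hP).1 hH).2

/-! ### The trace form -/

lemma metric_comm {n : ℕ} (X Y : Mat n) : metric X Y = metric Y X := by
  rw [metric, Matrix.trace_mul_comm, metric]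

lemma metric_self_eq_norm_sq {n : ℕ} {X : Mat n} (hX : Xᴴ = X) : metric X X = ‖X‖ ^ 2 := by
  have h1 : ‖X‖ ^ 2 = ∑ i, ∑ j, ‖X i j‖ ^ 2 := by
    have h0 : 0 ≤ ∑ i, ∑ j, ‖X i j‖ ^ (2 : ℝ) :=
      Finset.sum_nonneg fun i _ => Finset.sum_nonneg fun j _ => by positivity
    rw [Matrix.frobenius_norm_def, ← Real.sqrt_eq_rpow, Real.sq_sqrt h0]
    simp
  have h2 : metric X X = (Xᴴ * X).trace.re := by rw [hX, metric]
  rw [h1, h2, Matrix.trace, Finset.sum_comm]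
  simp only [Matrix.diag_apply, Matrix.mul_apply, Matrix.conjTranspose_apply, Complex.re_sum]
  refine Finset.sum_congr rfl fun i _ => Finset.sum_congr rfl fun j _ => ?_
  rw [Complex.star_def, ← Complex.normSq_eq_conj_mul_self, Complex.ofReal_re,
    Complex.normSq_eq_norm_sq]

/-- The trace form as a bounded bilinear map. -/
def metricCLM (n : ℕ) : Mat n →L[ℝ] Mat n →L[ℝ] ℝ :=
  LinearMap.toContinuousLinearMap
    ((LinearMap.toContinuousLinearMap : (Mat n →ₗ[ℝ] ℝ) ≃ₗ[ℝ] _).toLinearMap ∘ₗ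
      LinearMap.mk₂ ℝ metric
        (fun _ _ _ => by simp [metric, add_mul, Matrix.trace_add])
        (fun _ _ _ => by simp [metric, Matrix.trace_smul])
        (fun _ _ _ => by simp [metric, mul_add, Matrix.trace_add])
        (fun _ _ _ => by simp [metric, Matrix.trace_smul]))

@[simp] lemma metricCLM_apply {n : ℕ} (X Y : Mat n) : metricCLM n X Y = metric X Y := rfl

/-- The form is definite on Hermitian matrices, and multiplication by `i` carries skew-Hermitian
matrices to these, reversing the sign of the form. -/
lemma eq_zero_of_metric_self {n : ℕ} {A : Mat n} (hA : Aᴴ = A ∨ Aᴴ = -A)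
    (h : metric A A = 0) : A = 0 := by
  rcases hA with hA | hA
  · rw [metric_self_eq_norm_sq hA] at h
    simpa using h
  · have h1 : (Complex.I • A)ᴴ = Complex.I • A := by
      rw [Matrix.conjTranspose_smul, hA]; simp
    have h2 : metric (Complex.I • A) (Complex.I • A) = 0 := by
      have : metric (Complex.I • A) (Complex.I • A) = - metric A A := by
        simp [metric, smul_smul]
      rw [this, h, neg_zero]
    rw [metric_self_eq_norm_sq h1] at h2
    simpa using h2

lemma metric_lie_right {n : ℕ} (X A Y : Mat n) : metric X ⁅A, Y⁆ = metric A ⁅Y, X⁆ := by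
  simp only [metric, Ring.lie_def, mul_sub, Matrix.trace_sub]
  congr 2
  · rw [Matrix.trace_mul_comm, mul_assoc]
  · rw [← mul_assoc, Matrix.trace_mul_comm]

lemma norm_sq_of_mem_Gr {m n : ℕ} {P : Mat n} (hP : P ∈ Gr m n) : ‖P‖ ^ 2 = m := by
  rw [← metric_self_eq_norm_sq hP.1, metric, hP.2.1, hP.2.2]; simp

/-! ### Geodesics -/

lemma real_smul_lie {n : ℕ} (t : ℝ) (X Y : Mat n) : ⁅t • X, Y⁆ = t • ⁅X, Y⁆ := by
  simp only [Ring.lie_def, smul_mul_assoc, mul_smul_comm, smul_sub]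

lemma grExp_smul {n : ℕ} (Q ξ : Mat n) (t : ℝ) :
    grExp Q (t • ξ) = conjExp (t • ⁅ξ, Q⁆) Q := by
  rw [grExp_eq_conjExp, real_smul_lie]

/-- With respect to the splitting given by `P`, tangent vectors are block off-diagonal and matrices
commuting with `P` are block diagonal, so the two are orthogonal. -/
lemma metric_eq_zero_of_commute {n : ℕ} {P X H : Mat n} (hP : P * P = P) (hX : Commute X P)
    (hH : H * P + P * H = H) : metric X H = 0 := by
  have h0 := mul_mul_eq_zero_of_tangent hP hH
  have h1 : (X * (H * P)).trace = 0 := by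
    calc (X * (H * P)).trace = (X * H * P * P).trace := by simp only [mul_assoc, hP]
      _ = ((P * X) * (H * P)).trace := by rw [Matrix.trace_mul_comm]; simp only [mul_assoc]
      _ = (X * (P * H * P)).trace := by rw [← hX.eq]; simp only [mul_assoc]
      _ = 0 := by rw [h0]; simp
  have h2 : (X * (P * H)).trace = 0 := by
    calc (X * (P * H)).trace = ((X * P) * (P * H)).trace := by
          rw [mul_assoc X P (P * H), ← mul_assoc P P H, hP]
      _ = (P * (X * (P * H))).trace := by rw [hX.eq]; simp only [mul_assoc]
      _ = (X * (P * H * P)).trace := by rw [Matrix.trace_mul_comm]; simp only [mul_assoc]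
      _ = 0 := by rw [h0]; simp
  rw [metric, ← hH, mul_add, Matrix.trace_add, h1, h2]
  simp

lemma commute_lie_of_tangent {n : ℕ} {P A H : Mat n} (hA : A * P + P * A = A)
    (hH : H * P + P * H = H) : Commute ⁅A, H⁆ P := by
  have e1 : A * P = A - P * A := eq_sub_of_add_eq hA
  have e2 : H * P = H - P * H := eq_sub_of_add_eq hH
  have key : ∀ A H : Mat n, A * P = A - P * A → H * P = H - P * H →
      A * H * P = P * (A * H) := by
    intro A H e1 e2
    rw [mul_assoc, e2, mul_sub, ← mul_assoc A P H, e1]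
    noncomm_ring
  rw [Commute, SemiconjBy, Ring.lie_def, sub_mul, mul_sub, key A H e1 e2, key H A e2 e1]

lemma lie_tangent {n : ℕ} {P : Mat n} (hP : P * P = P) (H : Mat n) :
    ⁅H, P⁆ * P + P * ⁅H, P⁆ = ⁅H, P⁆ := by
  calc ⁅H, P⁆ * P + P * ⁅H, P⁆ = H * (P * P) - (P * P) * H := by
        simp only [Ring.lie_def]; noncomm_ring
    _ = _ := by rw [hP, Ring.lie_def]

lemma deriv_conjExp_const {n : ℕ} (A Q : Mat n) :
    deriv (fun s : ℝ => conjExp (s • A) Q) = fun t : ℝ => conjExp (t • A) ⁅A, Q⁆ :=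
  funext fun t => (hasDerivAt_conjExp_const A Q t).deriv

lemma isGeodesic_grExp {m n : ℕ} {Q ξ : Mat n} (hQ : Q ∈ Gr m n) (hξ : ξ ∈ tangentSpace m Q) :
    IsGeodesic m fun t : ℝ => grExp Q (t • ξ) := by
  have hA := skew_of_mem_tangentSpace hQ hξ
  have hT := ((mem_tangentSpace_iff hQ).1 hξ).2
  simp only [grExp_smul]
  refine ⟨isSmoothCurve_conjExp hA hQ, fun t H hH => ?_⟩
  have hG : conjExp (t • ⁅ξ, Q⁆) Q ∈ Gr m n :=
    conjExp_mem_Gr (conjTranspose_smul_of_skew hA t) hQ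
  have hd : deriv (deriv fun s : ℝ => conjExp (s • ⁅ξ, Q⁆) Q) t =
      conjExp (t • ⁅ξ, Q⁆) ⁅⁅ξ, Q⁆, ⁅⁅ξ, Q⁆, Q⁆⁆ := by
    rw [deriv_conjExp_const, deriv_conjExp_const]
  rw [hd]
  refine metric_eq_zero_of_commute hG.2.1 ?_ ((mem_tangentSpace_iff hG).1 hH).2
  -- The acceleration is a conjugate of `⁅⁅ξ, Q⁆, ξ⁆`, a commutator of two off-diagonal matrices,
  -- hence block diagonal.
  have hc : Commute ⁅⁅ξ, Q⁆, ⁅⁅ξ, Q⁆, Q⁆⁆ Q := by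
    rw [lie_lie_of_mem_tangentSpace hQ hξ]
    exact commute_lie_of_tangent (lie_tangent hQ.2.1 ξ) hT
  rw [Commute, SemiconjBy, ← conjExp_mul, ← conjExp_mul, hc.eq]

lemma eq_of_deriv_zero {n : ℕ} {f : ℝ → Mat n} (h : ∀ t, HasDerivAt f 0 t) (t : ℝ) :
    f t = f 0 :=
  is_const_of_deriv_eq_zero (fun t => (h t).differentiableAt) (fun t => (h t).deriv) t 0

/-- Along a geodesic, `[γ, γ']` is constant. -/
lemma lie_deriv_const_of_isGeodesic {m n : ℕ} {γ : ℝ → Mat n} (hγ : IsGeodesic m γ) (t : ℝ) :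
    ⁅γ t, deriv γ t⁆ = ⁅γ 0, deriv γ 0⁆ := by
  obtain ⟨⟨hs, hg⟩, ho⟩ := hγ
  have hs' : ContDiff ℝ ∞ (deriv γ) := hs.deriv'
  have d0 : Differentiable ℝ γ := hs.differentiable (by simp)
  have d1 : Differentiable ℝ (deriv γ) := hs'.differentiable (by simp)
  -- With `B = ⁅γ, γ''⁆`, testing the geodesic equation on the tangent vector `⁅B, γ⁆` yields
  -- `metric B B = 0`.
  have hz : ∀ t, ⁅γ t, deriv (deriv γ) t⁆ = 0 := by
    intro t
    have e1 : (deriv (deriv γ) t)ᴴ = deriv (deriv γ) t :=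
      conjTranspose_deriv (fun s => conjTranspose_deriv (fun u => (hg u).1) (d0 s)) (d1 t)
    have hB := conjTranspose_lie_skew e1 (hg t).1
    have := ho t _ (lie_mem_tangentSpace hB (hg t))
    rw [metric_lie_right] at this
    exact eq_zero_of_metric_self (Or.inr hB) this
  refine eq_of_deriv_zero (f := fun t => ⁅γ t, deriv γ t⁆) (fun t => ?_) t
  have h0 := (d0 t).hasDerivAt
  have h1 := (d1 t).hasDerivAt
  have h2 := (h0.mul h1).sub (h1.mul h0)
  have key : deriv γ t * deriv γ t + γ t * deriv (deriv γ) t -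
      (deriv (deriv γ) t * γ t + deriv γ t * deriv γ t) = 0 := by
    have := hz t
    rw [Ring.lie_def] at this
    rw [← this]; abel
  exact h2.congr_deriv key

lemma eq_grExp_of_isGeodesic {m n : ℕ} {γ : ℝ → Mat n} (hγ : IsGeodesic m γ) :
    γ = fun t => grExp (γ 0) (t • deriv γ 0) := by
  have hc := lie_deriv_const_of_isGeodesic hγ
  obtain ⟨⟨hs, hg⟩, -⟩ := hγ
  have d0 : Differentiable ℝ γ := hs.differentiable (by simp)
  set A := ⁅deriv γ 0, γ 0⁆ with hA
  have hd : ∀ t, deriv γ t = ⁅A, γ t⁆ := by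
    intro t
    have ht : deriv γ t ∈ tangentSpace m (γ t) :=
      (mem_tangentSpace_iff (hg t)).2 ⟨conjTranspose_deriv (fun u => (hg u).1) (d0 t),
        deriv_mul_add_mul_deriv (fun u => (hg u).2.1) (d0 t)⟩
    have h1 := lie_lie_of_mem_tangentSpace (hg t) ht
    have h2 : ⁅deriv γ t, γ t⁆ = A := by
      have := congrArg (fun X => -X) (hc t)
      simpa only [hA, Ring.lie_def, neg_sub] using this
    rw [← h1, h2]
  -- The geodesic solves the linear equation `γ' = ⁅A, γ⁆` with constant `A`; undoing the flow of
  -- `A` leaves a constant.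
  have hconst : ∀ t, conjExp (t • (-A)) (γ t) = γ 0 := by
    intro t
    have := eq_of_deriv_zero (f := fun t => conjExp (t • (-A)) (γ t)) (fun t => by
      have h := hasDerivAt_conjExp (-A) (d0 t).hasDerivAt
      refine h.congr_deriv ?_
      have hz : ⁅-A, γ t⁆ + deriv γ t = 0 := by
        rw [hd t]; simp only [Ring.lie_def]; noncomm_ring
      rw [conjExp]
      exact (congrArg (fun X => NormedSpace.exp (t • (-A)) * X *
        NormedSpace.exp (-(t • (-A)))) hz).trans (by simp)) t
    simpa [conjExp_zero_left] using this
  funext t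
  rw [grExp_smul, ← hA]
  conv_rhs => rw [← hconst t, smul_neg]
  simpa using (conjExp_neg_conjExp (-(t • A)) (γ t)).symm

lemma deriv_grExp_zero {m n : ℕ} {Q ξ : Mat n} (hQ : Q ∈ Gr m n) (hξ : ξ ∈ tangentSpace m Q) :
    deriv (fun t : ℝ => grExp Q (t • ξ)) 0 = ξ := by
  simp only [grExp_smul]
  refine (hasDerivAt_conjExp_const _ Q 0).deriv.trans ?_
  rw [zero_smul, conjExp_zero_left, lie_lie_of_mem_tangentSpace hQ hξ]

/-! ### Lengths of curves -/

lemma curveLength_nonneg {n : ℕ} (γ : ℝ → Mat n) : 0 ≤ curveLength γ :=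
  intervalIntegral.integral_nonneg zero_le_one fun _ _ => Real.sqrt_nonneg _

lemma derivWithin_Icc {n : ℕ} {γ : ℝ → Mat n} {γ' : Mat n} {t : ℝ} (h : HasDerivAt γ γ' t)
    (ht : t ∈ Icc (0 : ℝ) 1) : derivWithin γ (Icc 0 1) t = γ' :=
  h.hasDerivWithinAt.derivWithin (uniqueDiffOn_Icc zero_lt_one t ht)

lemma curveLength_le {n : ℕ} {γ γ' : ℝ → Mat n} {M : ℝ} (h : ∀ t, HasDerivAt γ (γ' t) t)
    (hM : ∀ t ∈ Icc (0 : ℝ) 1, metric (γ' t) (γ' t) ≤ M) : curveLength γ ≤ √M := by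
  have := intervalIntegral.norm_integral_le_of_norm_le_const (a := (0 : ℝ)) (b := 1) (C := √M)
    (f := fun t => √(metric (derivWithin γ (Icc 0 1) t) (derivWithin γ (Icc 0 1) t)))
    (fun t ht => by
      rw [uIoc_of_le zero_le_one] at ht
      have ht' : t ∈ Icc (0 : ℝ) 1 := Ioc_subset_Icc_self ht
      rw [derivWithin_Icc (h t) ht', Real.norm_of_nonneg (Real.sqrt_nonneg _)]
      exact Real.sqrt_le_sqrt (hM t ht'))
  rw [sub_zero, abs_one, mul_one] at this
  exact (Real.le_norm_self _).trans this

lemma curveLength_grExp {m n : ℕ} {Q ξ : Mat n} (hQ : Q ∈ Gr m n)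
    (hξ : ξ ∈ tangentSpace m Q) : curveLength (fun t : ℝ => grExp Q (t • ξ)) = ‖ξ‖ := by
  have hT := (mem_tangentSpace_iff hQ).1 hξ
  simp only [grExp_smul]
  rw [curveLength, intervalIntegral.integral_congr (g := fun _ => ‖ξ‖)]
  · simp
  · intro t ht
    rw [uIcc_of_le zero_le_one] at ht
    have := derivWithin_Icc (hasDerivAt_conjExp_const ⁅ξ, Q⁆ Q t) ht
    simp only [this, metric_conjExp, lie_lie_of_mem_tangentSpace hQ hξ,
      metric_self_eq_norm_sq hT.1, Real.sqrt_sq (norm_nonneg ξ)]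

lemma grDist_le {m n : ℕ} {P Q : Mat n} {γ : ℝ → Mat n}
    (h : ContDiffOn ℝ 1 γ (Icc 0 1)) (hg : ∀ t ∈ Icc (0 : ℝ) 1, γ t ∈ Gr m n)
    (h0 : γ 0 = P) (h1 : γ 1 = Q) : grDist m P Q ≤ curveLength γ :=
  csInf_le ⟨0, by rintro _ ⟨γ, -, -, -, -, rfl⟩; exact curveLength_nonneg γ⟩
    ⟨γ, h, hg, h0, h1, rfl⟩

lemma grDist_nonneg {m n : ℕ} (P Q : Mat n) : 0 ≤ grDist m P Q :=
  Real.sInf_nonneg (by rintro _ ⟨γ, -, -, -, -, rfl⟩; exact curveLength_nonneg γ)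

lemma curveLength_reverse {n : ℕ} (γ : ℝ → Mat n) :
    curveLength (fun t => γ (1 - t)) = curveLength γ := by
  have hset : (1 : ℝ) +ᵥ -Icc (0 : ℝ) 1 = Icc 0 1 := by
    ext x
    rw [mem_vadd_set_iff_neg_vadd_mem, Set.mem_neg, vadd_eq_add, mem_Icc, mem_Icc]
    constructor <;> rintro ⟨h1, h2⟩ <;> constructor <;> linarith
  have hd : ∀ t, derivWithin (fun t => γ (1 - t)) (Icc 0 1) t =
      -derivWithin γ (Icc 0 1) (1 - t) := by
    intro t
    have := derivWithin_comp_const_sub γ 1 (Icc 0 1) t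
    rw [hset] at this
    exact this
  have := intervalIntegral.integral_comp_sub_left (a := (0 : ℝ)) (b := 1)
    (fun t => √(metric (derivWithin γ (Icc 0 1) t) (derivWithin γ (Icc 0 1) t))) 1
  simp only [sub_self, sub_zero] at this
  simp only [curveLength]
  rw [← this]
  simp only [hd, metric, neg_mul_neg]

lemma grDist_comm {m n : ℕ} (P Q : Mat n) : grDist m P Q = grDist m Q P := by
  have hmap : MapsTo (fun t : ℝ => 1 - t) (Icc 0 1) (Icc 0 1) := fun t ht =>
    ⟨by linarith [ht.2], by linarith [ht.1]⟩
  have key : ∀ P Q : Mat n, {l : ℝ | ∃ γ : ℝ → Mat n, ContDiffOn ℝ 1 γ (Icc 0 1) ∧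
      (∀ t ∈ Icc (0 : ℝ) 1, γ t ∈ Gr m n) ∧ γ 0 = P ∧ γ 1 = Q ∧ l = curveLength γ} ⊆
      {l : ℝ | ∃ γ : ℝ → Mat n, ContDiffOn ℝ 1 γ (Icc 0 1) ∧
      (∀ t ∈ Icc (0 : ℝ) 1, γ t ∈ Gr m n) ∧ γ 0 = Q ∧ γ 1 = P ∧ l = curveLength γ} := by
    rintro P Q _ ⟨γ, h1, h2, h3, h4, rfl⟩
    refine ⟨fun t => γ (1 - t), ?_, fun t ht => h2 _ (hmap ht), by simpa, by simpa,
      (curveLength_reverse γ).symm⟩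
    exact h1.comp (by fun_prop) hmap
  exact congrArg sInf ((key P Q).antisymm (key Q P))

lemma grDist_self {m n : ℕ} {P : Mat n} (hP : P ∈ Gr m n) : grDist m P P = 0 := by
  refine le_antisymm ?_ (grDist_nonneg P P)
  have := grDist_le (m := m) (γ := fun _ => P) contDiffOn_const (fun _ _ => hP) rfl rfl
  have h := curveLength_le (γ := fun _ => P) (γ' := fun _ => 0) (M := 0)
    (fun t => hasDerivAt_const t P) (fun t _ => by simp [metric])
  exact this.trans (h.trans (by simp))

/-! ### Logarithms -/

/-- One inequality suffices: the geodesic itself competes in the infimum, which gives the other. -/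
lemma isLogarithm_of_norm_le {m n : ℕ} {Q P ξ : Mat n} (hQ : Q ∈ Gr m n)
    (hξ : ξ ∈ tangentSpace m Q) (hP : grExp Q ξ = P) (hle : ‖ξ‖ ≤ grDist m Q P) :
    IsLogarithm m Q P ξ := by
  have hgeo := isGeodesic_grExp hQ hξ
  have h0 : grExp Q ((0 : ℝ) • ξ) = Q := by
    rw [grExp_smul, zero_smul, conjExp_zero_left]
  have h1 : grExp Q ((1 : ℝ) • ξ) = P := by rw [one_smul, hP]
  refine ⟨hξ, hP.symm, hgeo, h0, h1, ?_⟩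
  rw [curveLength_grExp hQ hξ]
  refine hle.antisymm ?_
  rw [← curveLength_grExp hQ hξ]
  exact grDist_le (hgeo.1.1.contDiffOn.of_le (by simp)) (fun t _ => hgeo.1.2 t) h0 h1

lemma IsLogarithm.norm_eq {m n : ℕ} {Q P ξ : Mat n} (hQ : Q ∈ Gr m n)
    (h : IsLogarithm m Q P ξ) : ‖ξ‖ = grDist m Q P := by
  rw [← curveLength_grExp hQ h.1]
  exact h.2.2.2.2.2

lemma existsUnique_isLogarithm {m n : ℕ} {Q P : Mat n} (hQ : Q ∈ Gr m n)
    (h : ∃! γ : ℝ → Mat n, IsShortestGeodesic m Q P γ) :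
    ∃! ξ : Mat n, IsLogarithm m Q P ξ := by
  obtain ⟨γ, hγ, huniq⟩ := h
  obtain ⟨hgeo, h0, h1, -⟩ := id hγ
  have heq := eq_grExp_of_isGeodesic hgeo
  rw [h0] at heq
  refine ⟨deriv γ 0, ⟨⟨γ, hgeo.1, h0, rfl⟩, ?_, ?_⟩, fun ξ hξ => ?_⟩
  · rw [← h1]
    simpa using congrFun heq 1
  · rwa [← heq]
  · rw [← huniq _ hξ.2.2, deriv_grExp_zero hQ hξ.1]

/-! ### First variation of the distance -/

lemma metric_add_self {n : ℕ} (X Y : Mat n) :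
    metric (X + Y) (X + Y) = metric X X + 2 * metric Y X + metric Y Y := by
  have h := metric_comm X Y
  simp only [← metricCLM_apply, map_add, add_apply] at *
  linarith

/-- The Frobenius norm is submultiplicative and `‖P‖² = m`, whence the factor `4m`. -/
lemma norm_lie_sq_le {m n : ℕ} {P : Mat n} (hP : P ∈ Gr m n) (A : Mat n) :
    ‖⁅A, P⁆‖ ^ 2 ≤ 4 * m * ‖A‖ ^ 2 := by
  have h1 : ‖⁅A, P⁆‖ ≤ 2 * ‖A‖ * ‖P‖ := by
    rw [Ring.lie_def]
    have h2 := norm_mul_le A P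
    have h3 := norm_mul_le P A
    have := norm_sub_le (A * P) (P * A)
    linarith
  calc ‖⁅A, P⁆‖ ^ 2 ≤ (2 * ‖A‖ * ‖P‖) ^ 2 := by gcongr
    _ = 4 * ‖P‖ ^ 2 * ‖A‖ ^ 2 := by ring
    _ = _ := by rw [norm_sq_of_mem_Gr hP]

/-- Moving the end point of a geodesic by the unitary `e^A` changes the squared distance by at
most the first variation, up to an error that is quadratic in `A`. -/
lemma grDist_conjExp_sq_le {m n : ℕ} {Q P ξ A : Mat n} (hQ : Q ∈ Gr m n)
    (hξ : ξ ∈ tangentSpace m Q) (hP : P = grExp Q ξ) (hA : Aᴴ = -A) :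
    grDist m Q (conjExp A P) ^ 2 ≤
      ‖ξ‖ ^ 2 + 2 * metric ⁅⁅ξ, Q⁆, P⁆ ⁅A, P⁆ + 4 * m * ‖A‖ ^ 2 := by
  set M := ‖ξ‖ ^ 2 + 2 * metric ⁅⁅ξ, Q⁆, P⁆ ⁅A, P⁆ + 4 * m * ‖A‖ ^ 2 with hM
  set Ω := ⁅ξ, Q⁆ with hΩ
  have hT := (mem_tangentSpace_iff hQ).1 hξ
  have hΩs : Ωᴴ = -Ω := skew_of_mem_tangentSpace hQ hξ
  have hΩQ : ⁅Ω, Q⁆ = ξ := lie_lie_of_mem_tangentSpace hQ hξ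
  have hγG : ∀ t : ℝ, conjExp (t • Ω) Q ∈ Gr m n := fun t =>
    conjExp_mem_Gr (conjTranspose_smul_of_skew hΩs t) hQ
  have hγ1 : conjExp ((1 : ℝ) • Ω) Q = P := by rw [one_smul, hP, grExp_eq_conjExp]
  have hγ' : ∀ t : ℝ, conjExp (t • Ω) ⁅Ω, Q⁆ = ⁅Ω, conjExp (t • Ω) Q⁆ := fun t => by
    rw [conjExp_lie, conjExp_smul_self]
  -- Conservation of momentum: the pairing is that of `A` with `⁅γ, γ'⁆`, which equals `-Ω` at every
  -- time because `Ω` commutes with `e^{tΩ}`.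
  have hmom : ∀ t : ℝ, metric ⁅Ω, conjExp (t • Ω) Q⁆ ⁅A, conjExp (t • Ω) Q⁆ =
      metric A ⁅Q, ξ⁆ := fun t => by
    have h1 : ⁅Q, ξ⁆ = (-1 : ℝ) • Ω := by
      rw [hΩ, neg_one_smul, Ring.lie_def, Ring.lie_def, neg_sub]
    have h2 : conjExp (t • Ω) ((-1 : ℝ) • Ω) = (-1 : ℝ) • Ω := by
      have := conjExp_smul_self Ω t
      rw [conjExp] at this
      rw [conjExp, mul_smul_comm, smul_mul_assoc, this]
    rw [metric_lie_right, ← hγ', ← conjExp_lie, hΩQ, h1, h2]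
  -- By conjugation invariance only `⁅A, γ⁆ + γ'` matters. Its cross term does not depend on `t` and
  -- may be evaluated at the end point `P`.
  have hspeed : ∀ t : ℝ, metric
      (conjExp (t • A) (⁅A, conjExp (t • Ω) Q⁆ + conjExp (t • Ω) ⁅Ω, Q⁆))
      (conjExp (t • A) (⁅A, conjExp (t • Ω) Q⁆ + conjExp (t • Ω) ⁅Ω, Q⁆)) ≤ M := fun t => by
    have hAγ : ⁅A, conjExp (t • Ω) Q⁆ᴴ = ⁅A, conjExp (t • Ω) Q⁆ :=
      ((mem_tangentSpace_iff (hγG t)).1 (lie_mem_tangentSpace hA (hγG t))).1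
    have h1 := norm_lie_sq_le (hγG t) A
    have h2 := hmom 1
    rw [hγ1] at h2
    rw [metric_conjExp, metric_add_self, metric_conjExp, hΩQ, metric_self_eq_norm_sq hT.1,
      metric_self_eq_norm_sq hAγ, ← hΩQ, hγ', hmom t, ← h2]
    rw [hΩQ, hM]
    linarith
  have hd : ∀ t : ℝ, HasDerivAt (fun s : ℝ => conjExp (s • A) (conjExp (s • Ω) Q)) _ t :=
    fun t => hasDerivAt_conjExp A (hasDerivAt_conjExp_const Ω Q t)
  have hlen := curveLength_le hd fun t _ => hspeed t
  have hsm : ContDiff ℝ ∞ fun s : ℝ => conjExp (s • A) (conjExp (s • Ω) Q) :=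
    contDiff_conjExp A (contDiff_conjExp Ω contDiff_const)
  have hdist : grDist m Q (conjExp A P) ≤ √M := by
    refine le_trans (grDist_le (hsm.contDiffOn.of_le (by simp))
      (fun t _ => conjExp_mem_Gr (conjTranspose_smul_of_skew hA t) (hγG t)) ?_ ?_) hlen
    · simp only [zero_smul, conjExp_zero_left]
    · rw [hγ1, one_smul]
  have hM0 : 0 ≤ M := by
    refine le_trans ?_ (hspeed 0)
    have hG := hγG 0
    rw [metric_conjExp, hγ', metric_self_eq_norm_sq]
    · positivity
    · rw [Matrix.conjTranspose_add]
      rw [((mem_tangentSpace_iff hG).1 (lie_mem_tangentSpace hA hG)).1,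
        ((mem_tangentSpace_iff hG).1 (lie_mem_tangentSpace hΩs hG)).1]
  calc grDist m Q (conjExp A P) ^ 2 ≤ √M ^ 2 := by
        gcongr
        exact grDist_nonneg _ _
    _ = M := Real.sq_sqrt hM0

/-! ### The unitary action is locally transitive, with control on the generator -/

/-- The inverse function theorem at `0`, where the derivative of the exponential is the identity. -/
lemma exists_local_log (n : ℕ) : ∃ g : Mat n → Mat n, Tendsto g (𝓝 1) (𝓝 0) ∧
    (∀ᶠ S in 𝓝 (1 : Mat n), NormedSpace.exp (g S) = S) ∧
    (∀ᶠ X in 𝓝 (0 : Mat n), g (NormedSpace.exp X) = X) ∧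
    g =O[𝓝 1] fun S => S - 1 := by
  have hf : HasStrictFDerivAt (NormedSpace.exp : Mat n → Mat n)
      ((ContinuousLinearEquiv.refl ℝ (Mat n) : Mat n ≃L[ℝ] Mat n) : Mat n →L[ℝ] Mat n) 0 :=
    hasStrictFDerivAt_exp_zero
  have h1 := hf.localInverse_tendsto
  have h2 := hf.eventually_right_inverse
  have h3 := hf.eventually_left_inverse
  have h4 := hf.to_localInverse.hasFDerivAt.isBigO_sub
  have h5 := h3.self_of_nhds
  rw [NormedSpace.exp_zero] at h1 h2 h4 h5
  rw [h5] at h4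
  simp only [sub_zero] at h4
  exact ⟨_, h1, h2, h3, h4⟩

lemma exp_eq_of_mul_eq_one {n : ℕ} {B S : Mat n} (h : S * NormedSpace.exp B = 1) :
    S = NormedSpace.exp (-B) := by
  calc S = S * (NormedSpace.exp B * NormedSpace.exp (-B)) := by
        rw [exp_mul_exp_neg, mul_one]
    _ = NormedSpace.exp (-B) := by rw [← mul_assoc, h, one_mul]

lemma reflection_mul_self {n : ℕ} {P : Mat n} (hP : P * P = P) :
    (2 • P - 1) * (2 • P - 1) = (1 : Mat n) := by
  calc (2 • P - 1) * (2 • P - 1) = 4 • (P * P) - 4 • P + (1 : Mat n) := by noncomm_ring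
    _ = 1 := by rw [hP]; simp

lemma exp_involution_conj {n : ℕ} {R : Mat n} (hR : R * R = 1) (X : Mat n) :
    NormedSpace.exp (R * X * R) = R * NormedSpace.exp X * R :=
  Matrix.exp_units_conj ⟨R, R, hR, hR⟩ X

/-- With the reflections `R = 2P - 1` and `R' = 2P' - 1`, the unitary `R'R` is near `1`; conjugation
by its square root carries `R` to `R'`, hence `P` to `P'`. So `A` is half the local logarithm of
`R'R`. -/
lemma exists_conjExp_eq {m n : ℕ} {P : Mat n} (hP : P ∈ Gr m n) :
    ∃ A : Mat n → Mat n, (∀ᶠ P' in 𝓝[Gr m n] P, (A P')ᴴ = -A P' ∧ conjExp (A P') P = P') ∧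
      A =O[𝓝[Gr m n] P] fun P' => P' - P := by
  obtain ⟨g, g1, g2, g3, g4⟩ := exists_local_log n
  set R : Mat n := 2 • P - 1 with hRdef
  have hR : R * R = 1 := reflection_mul_self hP.2.1
  have hRs : Rᴴ = R := by
    rw [hRdef, Matrix.conjTranspose_sub, Matrix.conjTranspose_nsmul, hP.1,
      Matrix.conjTranspose_one]
  let S : Mat n → Mat n := fun P' => (2 • P' - 1) * R
  have hS : Tendsto S (𝓝[Gr m n] P) (𝓝 1) := by
    have : Continuous S := by fun_prop
    have h := this.tendsto P
    have e : S P = 1 := hR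
    rw [e] at h
    exact h.mono_left nhdsWithin_le_nhds
  have hB : Tendsto (fun P' => g (S P')) (𝓝[Gr m n] P) (𝓝 0) := g1.comp hS
  have hBstar : Tendsto (fun P' => (g (S P'))ᴴ) (𝓝[Gr m n] P) (𝓝 0) := by
    have h := ((continuous_id (X := Mat n)).matrix_conjTranspose.tendsto 0).comp hB
    simp only [id, Matrix.conjTranspose_zero] at h
    exact h
  have hBneg : Tendsto (fun P' => -g (S P')) (𝓝[Gr m n] P) (𝓝 0) := by
    simpa using hB.neg
  have hBconj : Tendsto (fun P' => R * g (S P') * R) (𝓝[Gr m n] P) (𝓝 0) := by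
    simpa using (hB.const_mul R).mul_const R
  refine ⟨fun P' => (1 / 2 : ℝ) • g (S P'), ?_, ?_⟩
  · filter_upwards [hS.eventually g2, hB.eventually g3, hBstar.eventually g3,
      hBneg.eventually g3, hBconj.eventually g3, self_mem_nhdsWithin]
      with P' e1 e2 e3 e4 e5 hP'
    set B := g (S P') with hBdef
    have hR' : (2 • P' - 1) * (2 • P' - 1) = (1 : Mat n) := reflection_mul_self hP'.2.1
    have hRs' : (2 • P' - 1 : Mat n)ᴴ = 2 • P' - 1 := by
      rw [Matrix.conjTranspose_sub, Matrix.conjTranspose_nsmul, hP'.1, Matrix.conjTranspose_one]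
    set R' : Mat n := 2 • P' - 1 with hRdef'
    have hSS : S P' = R' * R := rfl
    have hinv : R * R' * (R' * R) = 1 := by
      calc R * R' * (R' * R) = R * (R' * R') * R := by noncomm_ring
        _ = 1 := by rw [hR', mul_one, hR]
    have hexpneg : R * R' = NormedSpace.exp (-B) :=
      exp_eq_of_mul_eq_one (by rw [e1, hSS, hinv])
    -- `Bᴴ`, `-B` and `R * B * R` are all small with exponential `R * R'`, the inverse of `S P'`, so
    -- the local left inverse `g` identifies them.
    have hskew : Bᴴ = -B := by
      rw [← e3, ← e4, Matrix.exp_conjTranspose, e1, ← hexpneg, hSS,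
        Matrix.conjTranspose_mul, hRs, hRs']
    have hodd : R * B * R = -B := by
      have h6 : R * (R' * R) * R = R * R' := by
        calc R * (R' * R) * R = R * R' * (R * R) := by noncomm_ring
          _ = _ := by rw [hR, mul_one]
      rw [← e5, ← e4, exp_involution_conj hR, e1, ← hexpneg, hSS, h6]
    set A : Mat n := (1 / 2 : ℝ) • B with hAdef
    have hAA : A + A = B := by rw [hAdef, ← add_smul]; norm_num
    have hAskew : Aᴴ = -A := conjTranspose_smul_of_skew hskew _
    have hAodd : R * A * R = -A := by
      rw [hAdef, mul_smul_comm, smul_mul_assoc, hodd, smul_neg]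
    refine ⟨hAskew, ?_⟩
    -- As `A` anticommutes with `R`, `e^A R e^{-A} = e^{2A} R = (R'R)R = R'`.
    have h1 : conjExp A R = R' := by
      have h2 : R * NormedSpace.exp (-A) * R = NormedSpace.exp A := by
        rw [← exp_involution_conj hR, mul_neg, neg_mul, hAodd, neg_neg]
      have h3 : R * NormedSpace.exp (-A) = NormedSpace.exp A * R := by
        rw [← h2, mul_assoc _ R R, hR, mul_one]
      rw [conjExp, mul_assoc, h3, ← mul_assoc,
        ← Matrix.exp_add_of_commute A A (Commute.refl A), hAA, e1, hSS, mul_assoc, hR, mul_one]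
    have h4 : conjExp A R = 2 • conjExp A P - 1 := by
      calc conjExp A R = 2 • conjExp A P - NormedSpace.exp A * NormedSpace.exp (-A) := by
            simp only [conjExp, hRdef]; noncomm_ring
        _ = _ := by rw [exp_mul_exp_neg]
    rw [h1, hRdef'] at h4
    have h5 : (2 : ℝ) • P' = (2 : ℝ) • conjExp A P := by
      have := sub_left_injective h4
      simpa only [two_smul] using this
    exact (smul_right_injective _ (two_ne_zero (α := ℝ)) h5).symm
  · have h1 : (fun P' => g (S P')) =O[𝓝[Gr m n] P] fun P' => S P' - 1 := g4.comp_tendsto hS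
    have h2 : (fun P' => S P' - 1) =O[𝓝[Gr m n] P] fun P' => P' - P := by
      refine IsBigO.of_bound (2 * ‖R‖) (Eventually.of_forall fun P' => ?_)
      have e : S P' - 1 = (P' - P) * (2 • R) := by
        calc S P' - 1 = (2 • P' - 1) * R - R * R := by rw [hR]
          _ = _ := by rw [hRdef]; noncomm_ring
      have h3 : ‖2 • R‖ ≤ 2 * ‖R‖ := by
        rw [two_smul, two_mul]; exact norm_add_le _ _
      rw [e]
      calc ‖(P' - P) * (2 • R)‖ ≤ ‖P' - P‖ * ‖2 • R‖ := norm_mul_le _ _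
        _ ≤ ‖P' - P‖ * (2 * ‖R‖) := by gcongr
        _ = _ := mul_comm _ _
    exact (h1.trans h2).const_smul_left (1 / 2 : ℝ)

/-! ### Asymptotics of the trace form -/

/-- The form factors through the product: `metric X Y = metric 1 (X * Y)`. -/
lemma exists_norm_metric_le (n : ℕ) :
    ∃ c : ℝ, ∀ X Y : Mat n, ‖metric X Y‖ ≤ c * (‖X‖ * ‖Y‖) := by
  have hb : IsBoundedLinearMap ℝ fun Z : Mat n => metric 1 Z :=
    (LinearMap.toContinuousLinearMap (metricCLM n 1).toLinearMap).isBoundedLinearMap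
  obtain ⟨c, hc, h⟩ := hb.bound
  refine ⟨c, fun X Y => ?_⟩
  have h1 : metric X Y = metric 1 (X * Y) := by rw [metric, metric, one_mul]
  rw [h1]
  refine (h (X * Y)).trans ?_
  gcongr
  exact norm_mul_le _ _

lemma metric_isBigO {n : ℕ} {ι : Type*} {l : Filter ι} (X Y : ι → Mat n) :
    (fun x => metric (X x) (Y x)) =O[l] fun x => ‖X x‖ * ‖Y x‖ := by
  obtain ⟨c, hc⟩ := exists_norm_metric_le n
  exact IsBigO.of_bound c (Eventually.of_forall fun x => by simpa using hc (X x) (Y x))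

lemma metric_isLittleO_right {n : ℕ} {ι : Type*} {l : Filter ι} {X Y : ι → Mat n} {D : ι → ℝ}
    (hX : X =O[l] fun _ => (1 : ℝ)) (hY : Y =o[l] D) :
    (fun x => metric (X x) (Y x)) =o[l] D := by
  simpa using (metric_isBigO X Y).trans_isLittleO (hX.norm_left.mul_isLittleO hY.norm_left)

lemma metric_isLittleO_left {n : ℕ} {ι : Type*} {l : Filter ι} {X Y : ι → Mat n} {D : ι → ℝ}
    (hX : X =o[l] fun _ => (1 : ℝ)) (hY : Y =O[l] D) :
    (fun x => metric (X x) (Y x)) =o[l] D := by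
  simpa using (metric_isBigO X Y).trans_isLittleO (hX.norm_left.mul_isBigO hY.norm_left)

lemma conjExp_sub_isLittleO {n : ℕ} (P : Mat n) :
    (fun A => conjExp A P - P - ⁅A, P⁆) =o[𝓝 0] fun A : Mat n => A := by
  have h1 : HasFDerivAt (NormedSpace.exp : Mat n → Mat n)
      (ContinuousLinearMap.id ℝ (Mat n)) 0 := hasFDerivAt_exp_zero
  have h2 : HasFDerivAt (fun A : Mat n => NormedSpace.exp (-A))
      (-ContinuousLinearMap.id ℝ (Mat n)) 0 := by
    have h1' : HasFDerivAt (NormedSpace.exp : Mat n → Mat n)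
      (ContinuousLinearMap.id ℝ (Mat n)) (-0) := by rw [neg_zero]; exact h1
    have := h1'.comp (0 : Mat n) (hasFDerivAt_id (𝕜 := ℝ) (0 : Mat n)).neg
    refine this.congr_fderiv ?_
    ext1 X
    rfl
  have h3 := ((h1.mul_const' P).mul' h2).isLittleO
  refine h3.congr (fun A => ?_) (fun A => sub_zero A)
  have e : ((NormedSpace.exp 0 * P) • -ContinuousLinearMap.id ℝ (Mat n) +
      MulOpposite.op (NormedSpace.exp (-0 : Mat n)) • MulOpposite.op P •
        ContinuousLinearMap.id ℝ (Mat n)) (A - 0) = ⁅A, P⁆ := by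
    change (NormedSpace.exp 0 * P) * -(A - 0) + (A - 0) * P * NormedSpace.exp (-0) = ⁅A, P⁆
    rw [neg_zero, NormedSpace.exp_zero, Ring.lie_def]
    noncomm_ring
  refine congrArg₂ (· - ·) ?_ e
  change NormedSpace.exp A * P * NormedSpace.exp (-A) -
    NormedSpace.exp 0 * P * NormedSpace.exp (-0) = _
  rw [neg_zero, NormedSpace.exp_zero, one_mul, mul_one, conjExp]

/-! ### The gradient of the squared distance -/

lemma tendsto_of_isBigO_sub {n : ℕ} {s : Set (Mat n)} {P : Mat n} {A : Mat n → Mat n}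
    (h : A =O[𝓝[s] P] fun P' => P' - P) : Tendsto A (𝓝[s] P) (𝓝 0) := by
  refine h.trans_tendsto ?_
  have : Tendsto (fun P' : Mat n => P' - P) (𝓝 P) (𝓝 (P - P)) :=
    (continuous_id.sub continuous_const).tendsto P
  rw [sub_self] at this
  exact this.mono_left nhdsWithin_le_nhds

lemma continuous_metric {n : ℕ} (X : Mat n) : Continuous fun Y : Mat n => metric X Y := by
  unfold metric
  fun_prop

lemma continuous_lie {n : ℕ} {ι : Type*} [TopologicalSpace ι] {f g : ι → Mat n}
    (hf : Continuous f) (hg : Continuous g) : Continuous fun x => ⁅f x, g x⁆ := by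
  simp only [Ring.lie_def]
  exact (hf.mul hg).sub (hg.mul hf)

lemma tendsto_lie {n : ℕ} {ι : Type*} {l : Filter ι} {f g : ι → Mat n} {X Y : Mat n}
    (hf : Tendsto f l (𝓝 X)) (hg : Tendsto g l (𝓝 Y)) :
    Tendsto (fun x => ⁅f x, g x⁆) l (𝓝 ⁅X, Y⁆) := by
  simp only [Ring.lie_def]
  exact (hf.mul hg).sub (hg.mul hf)

lemma continuous_grExp {n : ℕ} (Q : Mat n) : Continuous fun H : Mat n => grExp Q H := by
  simp only [grExp_eq_conjExp]
  exact continuous_conjExp (continuous_lie continuous_id continuous_const) continuous_const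

lemma sum_lie_const {n : ℕ} {ι : Type*} (s : Finset ι) (A : ι → Mat n) (P : Mat n) :
    ∑ i ∈ s, ⁅A i, P⁆ = ⁅∑ i ∈ s, A i, P⁆ := by
  simp only [Ring.lie_def, Finset.sum_sub_distrib, Matrix.sum_mul, Matrix.mul_sum]

/-- The squared distance is upper semicontinuous at the end point of a shortest geodesic. -/
lemma eventually_grDist_sq_lt {m n : ℕ} {Q P ξ : Mat n} (hQ : Q ∈ Gr m n) (hP : P ∈ Gr m n)
    (hξ : IsLogarithm m Q P ξ) {c : ℝ} (hc : grDist m Q P ^ 2 < c) :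
    ∀ᶠ P' in 𝓝[Gr m n] P, grDist m Q P' ^ 2 < c := by
  obtain ⟨A, hA, hAO⟩ := exists_conjExp_eq hP
  have hA0 := tendsto_of_isBigO_sub hAO
  have hcont : Continuous fun A : Mat n =>
      ‖ξ‖ ^ 2 + 2 * metric ⁅⁅ξ, Q⁆, P⁆ ⁅A, P⁆ + 4 * m * ‖A‖ ^ 2 := by
    have h1 : Continuous fun A : Mat n => metric ⁅⁅ξ, Q⁆, P⁆ ⁅A, P⁆ :=
      (continuous_metric _).comp (continuous_lie continuous_id continuous_const)
    exact ((continuous_const.add (continuous_const.mul h1)).add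
      (continuous_const.mul (continuous_norm.pow 2)))
  have h0 := (hcont.tendsto 0).comp hA0
  have e : ‖ξ‖ ^ 2 + 2 * metric ⁅⁅ξ, Q⁆, P⁆ ⁅(0 : Mat n), P⁆ + 4 * m * ‖(0 : Mat n)‖ ^ 2 =
      grDist m Q P ^ 2 := by
    rw [hξ.norm_eq hQ]
    simp [Ring.lie_def, metric]
  rw [e] at h0
  filter_upwards [hA, h0.eventually_lt_const hc] with P' h1 h2
  have h3 := grDist_conjExp_sq_le hQ hξ.1 hξ.2.1 h1.1
  rw [h1.2] at h3
  exact h3.trans_lt h2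

/-- If the logarithm of `P` is unique, then logarithms are continuous at `P`. -/
lemma tendsto_logarithm {m n : ℕ} {Q P ξ : Mat n} (hQ : Q ∈ Gr m n) (hP : P ∈ Gr m n)
    (hξ : IsLogarithm m Q P ξ) (huniq : ∀ ξ', IsLogarithm m Q P ξ' → ξ' = ξ)
    {Ξ : Mat n → Mat n} (hΞ : ∀ᶠ P' in 𝓝[Gr m n] P, IsLogarithm m Q P' (Ξ P')) :
    Tendsto Ξ (𝓝[Gr m n] P) (𝓝 ξ) := by
  have hbd : ∀ c, grDist m Q P ^ 2 < c → ∀ᶠ P' in 𝓝[Gr m n] P, ‖Ξ P'‖ ^ 2 < c := by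
    intro c hc
    filter_upwards [hΞ, eventually_grDist_sq_lt hQ hP hξ hc] with P' h1 h2
    rwa [h1.norm_eq hQ]
  -- The logarithms eventually stay in a compact ball, so it is enough that every cluster point is a
  -- logarithm of `P`.
  refine (isCompact_closedBall (0 : Mat n) (grDist m Q P + 1)).tendsto_nhds_of_unique_mapClusterPt
    ?_ fun y _ hy => huniq y ?_
  · have hd := grDist_nonneg (m := m) Q P
    filter_upwards [hbd ((grDist m Q P + 1) ^ 2) (by nlinarith)] with P' h
    rw [mem_closedBall_zero_iff]
    exact (lt_of_pow_lt_pow_left₀ 2 (by positivity) h).le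
  · obtain ⟨U, hU, hy⟩ := mapClusterPt_iff_ultrafilter.1 hy
    have htan : y ∈ tangentSpace m Q := by
      rw [mem_tangentSpace_iff hQ]
      have hev : ∀ᶠ P' in (U : Filter (Mat n)),
          (Ξ P')ᴴ = Ξ P' ∧ Ξ P' * Q + Q * Ξ P' = Ξ P' :=
        (hΞ.filter_mono hU).mono fun P' h => (mem_tangentSpace_iff hQ).1 h.1
      have hclosed : IsClosed {H : Mat n | Hᴴ = H ∧ H * Q + Q * H = H} :=
        (isClosed_eq (continuous_id.matrix_conjTranspose) continuous_id).inter
          (isClosed_eq (by fun_prop) continuous_id)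
      exact hclosed.mem_of_tendsto hy hev
    have hexp : grExp Q y = P := by
      have h1 : Tendsto (fun P' => grExp Q (Ξ P')) U (𝓝 (grExp Q y)) := by
        exact ((continuous_grExp Q).tendsto y).comp hy
      have h2 : Tendsto (fun P' : Mat n => P') U (𝓝 P) :=
        tendsto_id.mono_left (hU.trans nhdsWithin_le_nhds)
      refine tendsto_nhds_unique h1 (h2.congr' ?_)
      exact (hΞ.filter_mono hU).mono fun P' h => h.2.1
    -- Upper semicontinuity of the distance bounds the limit by `dist(Q, P)`, so the limiting
    -- geodesic is shortest.
    refine isLogarithm_of_norm_le hQ htan hexp ?_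
    have h1 : ‖y‖ ^ 2 ≤ grDist m Q P ^ 2 := by
      refine le_of_forall_gt_imp_ge_of_dense fun c hc => ?_
      exact le_of_tendsto (hy.norm.pow 2) (((hbd c hc).filter_mono hU).mono fun _ h => h.le)
    exact (sq_le_sq₀ (norm_nonneg y) (grDist_nonneg Q P)).1 h1

/-- The increment of the squared distance is squeezed between two first variations, one along the
geodesic to `P` and one along that to `P'`, which agree to first order. -/
lemma hasFDerivWithinAt_grDist_sq {m n : ℕ} {Q P ξ : Mat n} (hQ : Q ∈ Gr m n)
    (hP : P ∈ Gr m n) (hξ : IsLogarithm m Q P ξ)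
    (huniq : ∀ ξ', IsLogarithm m Q P ξ' → ξ' = ξ)
    (hex : ∀ᶠ P' in 𝓝[Gr m n] P, ∃ ξ', IsLogarithm m Q P' ξ') :
    HasFDerivWithinAt (fun P' => grDist m Q P' ^ 2) (metricCLM n ((2 : ℝ) • ⁅⁅ξ, Q⁆, P⁆))
      (Gr m n) P := by
  set l := 𝓝[Gr m n] P with hl
  obtain ⟨A, hA, hAO⟩ := exists_conjExp_eq hP
  have hA0 : Tendsto A l (𝓝 0) := tendsto_of_isBigO_sub hAO
  obtain ⟨Ξ, hΞ⟩ : ∃ Ξ : Mat n → Mat n, ∀ᶠ P' in l, IsLogarithm m Q P' (Ξ P') := by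
    classical
    -- The default `0` is irrelevant, since logarithms exist for all `P'` close to `P`.
    refine ⟨fun P' => if h : ∃ ξ', IsLogarithm m Q P' ξ' then h.choose else 0, ?_⟩
    filter_upwards [hex] with P' h
    rw [dif_pos h]
    exact h.choose_spec
  have hΞt : Tendsto Ξ l (𝓝 ξ) := tendsto_logarithm hQ hP hξ huniq hΞ
  have hid : Tendsto (fun P' : Mat n => P') l (𝓝 P) := tendsto_id.mono_left nhdsWithin_le_nhds
  set v := ⁅⁅ξ, Q⁆, P⁆ with hv
  set w : Mat n → Mat n := fun P' => ⁅⁅Ξ P', Q⁆, P'⁆ with hw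
  have hwt : Tendsto w l (𝓝 v) := tendsto_lie (tendsto_lie hΞt tendsto_const_nhds) hid
  set D : Mat n → ℝ := fun P' => ‖P' - P‖ with hD
  have hΔ : (fun P' => P' - P) =O[l] D := isBigO_refl _ _ |>.norm_right
  have hAD : A =O[l] D := hAO.norm_right
  have hA1 : A =o[l] fun _ => (1 : ℝ) := (isLittleO_one_iff ℝ).2 hA0
  -- `P'` is the conjugate of `P` by `e^{A P'}`, whose linear term in `A P'` is `⁅A P', P⁆`.
  have hE : (fun P' => ⁅A P', P⁆ - (P' - P)) =o[l] D := by
    have h1 := ((conjExp_sub_isLittleO P).comp_tendsto hA0).trans_isBigO hAD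
    refine h1.neg_left.congr' ?_ EventuallyEq.rfl
    filter_upwards [hA] with P' h
    simp only [Function.comp, h.2]
    abel
  have hquad : (fun P' => 4 * m * ‖A P'‖ ^ 2) =o[l] D := by
    have h1 := (hA1.norm_left.mul_isBigO hAD.norm_left).const_mul_left (4 * m : ℝ)
    simpa [pow_two] using h1
  have hAΔ : (fun P' => ⁅A P', P' - P⁆) =o[l] D := by
    simp only [Ring.lie_def]
    refine IsLittleO.sub ?_ ?_
    · simpa using hA1.mul_isBigO hΔ
    · simpa using hΔ.mul_isLittleO hA1
  have hw1 : w =O[l] fun _ => (1 : ℝ) := hwt.isBigO_one ℝ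
  have hwv : (fun P' => w P' - v) =o[l] fun _ => (1 : ℝ) := by
    rw [isLittleO_one_iff]
    have h := hwt.sub_const v
    rw [sub_self] at h
    exact h
  have hupper : (fun P' => 2 * metric v (⁅A P', P⁆ - (P' - P)) + 4 * m * ‖A P'‖ ^ 2) =o[l] D :=
    ((metric_isLittleO_right (isBigO_const_const v one_ne_zero l) hE).const_mul_left 2).add hquad
  -- The remainder when the variation starts at `P'` with generator `-A P'`: `⁅A P', P'⁆` is split
  -- into `P' - P` and two small errors, and `w P'` is compared with its limit `v`.
  have hlower : (fun P' => 2 * (metric (w P') (⁅A P', P⁆ - (P' - P)) +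
      metric (w P') ⁅A P', P' - P⁆ + metric (w P' - v) (P' - P)) - 4 * m * ‖A P'‖ ^ 2)
        =o[l] D :=
    ((((metric_isLittleO_right hw1 hE).add (metric_isLittleO_right hw1 hAΔ)).add
      (metric_isLittleO_left hwv hΔ)).const_mul_left 2).sub hquad
  have hsum := isLittleO_norm_right.1 (hupper.norm_left.add hlower.norm_left)
  suffices key : (fun P' => grDist m Q P' ^ 2 - grDist m Q P ^ 2 -
      metricCLM n ((2 : ℝ) • v) (P' - P)) =o[l] fun P' => P' - P from .of_isLittleO key
  refine IsBigO.trans_isLittleO ?_ hsum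
  refine IsBigO.of_bound 1 ?_
  filter_upwards [hA, hΞ, self_mem_nhdsWithin] with P' hA' hΞ' hP'
  have u := grDist_conjExp_sq_le hQ hξ.1 hξ.2.1 hA'.1
  rw [hA'.2, hξ.norm_eq hQ, ← hv] at u
  have hneg : (-A P')ᴴ = -(-A P') := by rw [Matrix.conjTranspose_neg, hA'.1]
  -- The generator `-A P'` moves `P'` back to `P`, so this bounds `dist²(Q, P)` from above, hence
  -- `dist²(Q, P')` from below.
  have d := grDist_conjExp_sq_le hQ hΞ'.1 hΞ'.2.1 hneg
  have hback := conjExp_neg_conjExp (A P') P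
  rw [hA'.2] at hback
  rw [hback, hΞ'.norm_eq hQ, norm_neg] at d
  have e1 : metric ⁅⁅Ξ P', Q⁆, P'⁆ ⁅-A P', P'⁆ =
      -(metric (w P') (⁅A P', P⁆ - (P' - P)) + metric (w P') ⁅A P', P' - P⁆ +
        metric (w P') (P' - P)) := by
    have : ⁅-A P', P'⁆ = -((⁅A P', P⁆ - (P' - P)) + ⁅A P', P' - P⁆ + (P' - P)) := by
      simp only [Ring.lie_def]; noncomm_ring
    rw [this, hw]
    simp only [← metricCLM_apply, map_add, map_neg]
  have e2 : metric (w P' - v) (P' - P) = metric (w P') (P' - P) - metric v (P' - P) := by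
    simp only [← metricCLM_apply, map_sub, sub_apply]
    ring
  have e3 : metric v (⁅A P', P⁆ - (P' - P)) = metric v ⁅A P', P⁆ - metric v (P' - P) := by
    simp only [← metricCLM_apply, map_sub]
  have e4 : metricCLM n ((2 : ℝ) • v) (P' - P) = 2 * metric v (P' - P) := by
    rw [map_smul, smul_apply, smul_eq_mul, metricCLM_apply]
  rw [e1] at d
  rw [e4, one_mul, e2, e3, Real.norm_eq_abs, Real.norm_eq_abs, Real.norm_eq_abs,
    Real.norm_eq_abs]
  refine le_trans ?_ (le_abs_self _)
  rw [abs_le]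
  have a1 := le_abs_self (2 * (metric v ⁅A P', P⁆ - metric v (P' - P)) + 4 * m * ‖A P'‖ ^ 2)
  have a2 := neg_abs_le (2 * (metric (w P') (⁅A P', P⁆ - (P' - P)) +
    metric (w P') ⁅A P', P' - P⁆ + (metric (w P') (P' - P) - metric v (P' - P))) -
      4 * m * ‖A P'‖ ^ 2)
  have b1 := abs_nonneg (2 * (metric v ⁅A P', P⁆ - metric v (P' - P)) + 4 * m * ‖A P'‖ ^ 2)
  have b2 := abs_nonneg (2 * (metric (w P') (⁅A P', P⁆ - (P' - P)) +
    metric (w P') ⁅A P', P' - P⁆ + (metric (w P') (P' - P) - metric v (P' - P))) -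
      4 * m * ‖A P'‖ ^ 2)
  constructor <;> linarith

/-! ### Convex balls -/

lemma IsGeodesicallyConvex.existsUnique_isLogarithm {m n : ℕ} {B : Set (Mat n)}
    (hB : IsGeodesicallyConvex m B) (hG : B ⊆ Gr m n) {Q P : Mat n} (hQ : Q ∈ B)
    (hP : P ∈ B) : ∃! ξ : Mat n, IsLogarithm m Q P ξ := by
  obtain ⟨γ, h1, -, h2⟩ := hB Q hQ P hP
  exact KarcherGrassmann.existsUnique_isLogarithm (hG hQ) ⟨γ, h1, h2⟩

lemma geodesicBall_subset_Gr {m n : ℕ} (C : Mat n) (r : ℝ) : geodesicBall m C r ⊆ Gr m n :=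
  fun _ h => h.1

/-- The ball is relatively open: it contains its centre, so convexity gives a shortest geodesic from
`C` to `P`, and along it the distance from `C` is upper semicontinuous at `P`. -/
lemma eventually_mem_geodesicBall {m n : ℕ} {C P : Mat n} {r : ℝ} (hC : C ∈ Gr m n)
    (hconv : IsGeodesicallyConvex m (geodesicBall m C r)) (hP : P ∈ geodesicBall m C r) :
    ∀ᶠ P' in 𝓝[Gr m n] P, P' ∈ geodesicBall m C r := by
  have hr : 0 < r := (grDist_nonneg C P).trans_lt hP.2
  have hCB : C ∈ geodesicBall m C r := ⟨hC, by rwa [grDist_self hC]⟩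
  obtain ⟨ξ, hξ, -⟩ := hconv.existsUnique_isLogarithm (geodesicBall_subset_Gr C r) hCB hP
  have hlt : grDist m C P ^ 2 < r ^ 2 := pow_lt_pow_left₀ hP.2 (grDist_nonneg C P) two_ne_zero
  filter_upwards [eventually_grDist_sq_lt hC hP.1 hξ hlt, self_mem_nhdsWithin] with P' h1 h2
  exact ⟨h2, lt_of_pow_lt_pow_left₀ 2 hr.le h1⟩

lemma hasRiemannianGradientAt_of_hasFDerivWithinAt {m n : ℕ} {f : Mat n → ℝ} {P G : Mat n}
    (hG : G ∈ tangentSpace m P) (hf : HasFDerivWithinAt f (metricCLM n G) (Gr m n) P) :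
    HasRiemannianGradientAt m f P G := by
  refine ⟨hG, hf.differentiableWithinAt, fun γ hγ h0 => ?_⟩
  have hd : HasDerivAt γ (deriv γ 0) 0 := ((hγ.1.differentiable (by simp)) 0).hasDerivAt
  rw [← h0] at hf
  exact hf.comp_hasDerivAt 0 hd (Eventually.of_forall hγ.2)

lemma conjTranspose_sum_of_skew {n : ℕ} {ι : Type*} (s : Finset ι) {A : ι → Mat n}
    (h : ∀ i, (A i)ᴴ = -A i) : (∑ i ∈ s, A i)ᴴ = -∑ i ∈ s, A i := by
  rw [Matrix.conjTranspose_sum, ← Finset.sum_neg_distrib]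
  exact Finset.sum_congr rfl fun i _ => h i

end KarcherGrassmann

end

/-! ### The gradient of the Karcher mean function. -/

open KarcherGrassmann in
theorem mainTheorem1 (m n N : ℕ) (hN : 1 ≤ N)
    (C : KarcherGrassmann.Mat n) (hC : C ∈ KarcherGrassmann.Gr m n) (r : ℝ)
    (hconv : KarcherGrassmann.IsGeodesicallyConvex m (KarcherGrassmann.geodesicBall m C r))
    (Q : Fin N → KarcherGrassmann.Mat n)
    (hQ : ∀ i, Q i ∈ KarcherGrassmann.geodesicBall m C r)
    (P : KarcherGrassmann.Mat n) (hP : P ∈ KarcherGrassmann.geodesicBall m C r) :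
    (∀ i, ∃! ξ : KarcherGrassmann.Mat n, KarcherGrassmann.IsLogarithm m (Q i) P ξ) ∧
    ∀ ξ : Fin N → KarcherGrassmann.Mat n,
      (∀ i, KarcherGrassmann.IsLogarithm m (Q i) P (ξ i)) →
      KarcherGrassmann.HasRiemannianGradientAt m (KarcherGrassmann.karcherMeanFunction m Q) P
        ((2 / (N : ℝ)) • ∑ i, ⁅⁅ξ i, Q i⁆, P⁆) := by
  have hsub := geodesicBall_subset_Gr (m := m) C r
  have hlog : ∀ i, ∃! ξ : Mat n, IsLogarithm m (Q i) P ξ := fun i =>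
    hconv.existsUnique_isLogarithm hsub (hQ i) hP
  refine ⟨hlog, fun ξ hξ => hasRiemannianGradientAt_of_hasFDerivWithinAt ?_ ?_⟩
  -- The candidate gradient is a single bracket of a skew-Hermitian matrix with `P`, hence tangent.
  · have h1 : (2 / (N : ℝ)) • ∑ i, ⁅⁅ξ i, Q i⁆, P⁆ = ⁅(2 / (N : ℝ)) • ∑ i, ⁅ξ i, Q i⁆, P⁆ := by
      rw [real_smul_lie, sum_lie_const]
    rw [h1]
    exact lie_mem_tangentSpace (conjTranspose_smul_of_skew (conjTranspose_sum_of_skew _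
      fun i => skew_of_mem_tangentSpace (hsub (hQ i)) (hξ i).1) _) hP.1
  · have hd : ∀ i, HasFDerivWithinAt (fun P' => grDist m (Q i) P' ^ 2)
        (metricCLM n ((2 : ℝ) • ⁅⁅ξ i, Q i⁆, P⁆)) (Gr m n) P := fun i =>
      hasFDerivWithinAt_grDist_sq (hsub (hQ i)) hP.1 (hξ i)
        (fun ξ' h => (hlog i).unique h (hξ i))
        ((eventually_mem_geodesicBall hC hconv hP).mono fun P' h =>
          (hconv.existsUnique_isLogarithm hsub (hQ i) h).exists)
    have hsum := (HasFDerivWithinAt.fun_sum (u := Finset.univ) fun i _ => hd i).const_mul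
      (1 / (N : ℝ))
    have hfun : karcherMeanFunction m Q =
        fun P' => 1 / (N : ℝ) * ∑ i, grDist m (Q i) P' ^ 2 := by
      funext P'
      -- The derivative was computed in the second argument of the distance, whereas the mean
      -- function varies the first.
      simp only [karcherMeanFunction, grDist_comm P']
    rw [hfun]
    have e : (1 / (N : ℝ)) • ∑ i, metricCLM n ((2 : ℝ) • ⁅⁅ξ i, Q i⁆, P⁆) =
        metricCLM n ((2 / (N : ℝ)) • ∑ i, ⁅⁅ξ i, Q i⁆, P⁆) := by
      rw [← map_sum, ← map_smul, ← Finset.smul_sum, smul_smul, one_div_mul_eq_div]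
    exact hsum.congr_fderiv e
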